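/- **Algorithm.** Fix $\mathbf t=(t_1,t_2,t_3)\in\mathbb N^3$ (with $0\in\mathbb N$), put $k=t_1+t_2+t_3+2$, and let $w\ge k-1$ be the Insertionsort threshold. Let the array $A[0..n-1]$ with $n>w$ hold a uniformly random permutation of $n$ distinct integers. In the first partitioning step of generalized Yaroslavskiy Quicksort, the sample consists of the $t_1+t_2+1$ leftmost and the $t_3+1$ rightmost elements. The sample is sorted in place, and the pivots $P<Q$ are its elements of ranks $t_1+1$ and $t_1+t_2+2$. The other $n-k$ elements are called ordinary. Let $\mathbf I=(I_1,I_2,I_3)$ be the numbers of ordinary elements that are $<P$ (small), strictly between $P$ and $Q$ (medium), and $>Q$ (large). The range $A[\mathit{left}..\mathit{right}]$ with $\mathit{left}=t_1+t_2+1$, $\mathit{right}=n-t_3-2$ of ordinary elements is then partitioned with $p=P$, $q=Q$ by the Java code ``` int l = left, g = right, k = l; while (k <= g) { final int ak = A[k]; if (ak < p) { A[k] = A[l]; A[l] = ak; ++l; } else if (ak >= q) { while (A[g] > q && k < g) --g; final int ag = A[g]; if (ag < p) { A[k] = A[l]; A[l] = ag; ++l; } else { A[k] = ag; } A[g] = ak;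 --g; } ++k; } --l; ++g; ``` (`int`s are treated as unbounded integers) compiled to the following Java Bytecode, where instructions are numbered from $0$, jump targets are instruction numbers, and variables are written by name: ``` 0: iload left; istore l; iload right; istore g; iload l; istore k 6: iload k; iload g; if_icmpgt 71 9: aload A; iload k; iaload; istore ak 13: iload ak; iload p; if_icmpge 28 16: aload A; iload k; aload A; iload l; iaload; iastore 22: aload A; iload l; iload ak; iastore; iinc l 1; goto 69 28: iload ak; iload q; if_icmplt 69 31: aload A; iload g; iaload; iload q; if_icmple 41 36: iload k; iload g; if_icmpge 41; iinc g -1; goto 31 41: aload A; iload g; iaload; istore ag 45: iload ag; iload p; if_icmpge 60 48: aload A; iload k; aload A; iload l; iaload; iastore 54: aload A; iload l; iload ag; iastore; iinc l 1; goto 64 60: aload A; iload k; iload ag; iastore 64: aload A; iload g; iload ak; iastore; iinc g -1 69: iinc k 1; goto 6 71: iinc l -1; iinc g 1 ``` Let $T_n$ be the number of Bytecode instructions executed by this code (the cost of sorting the sample is not counted). For integers $d,r,m\ge0$ with $d,r\le m$, let $\mathrm{Hyp}(d,r,m)$ denote the distribution of the number of red balls when drawing $d$ times without replacement from an urn of $m$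 balls, $r$ of which are red. **Lemma 5.3.** The code always terminates without error, and conditional on $\mathbf I$, $$T_n \overset{\mathcal D}{=} 10n+13I_1+5I_2+11\,\mathrm{Hyp}(I_1+I_2,I_3,n-k)+\mathrm{Hyp}(I_1,I_1+I_2,n-k)+O(1).$$ Precisely: for every $\mathbf t$ there is a constant $C$ such that for all $w\ge k-1$ and all $n>w$ there are $\mathbb N$-valued random variables $X,Y$ on the probability space of the input permutations with $$\bigl|T_n-(10n+13I_1+5I_2+11X+Y)\bigr|\le C$$ for every input, such that for every value $(i_1,i_2,i_3)$ that $\mathbf I$ attains, conditional on $\mathbf I=(i_1,i_2,i_3)$, * $X$ has the distribution $\mathrm{Hyp}(i_1+i_2,i_3,n-k)$, * $Y$ has the distribution $\mathrm{Hyp}(i_1,i_1+i_2,n-k)$, and * the joint law of $(X,Y)$ is that of the numbers of red and of blue balls when drawing $i_1+i_2$ times without replacement from one urn of $n-k$ balls, $i_3$ of which are red and $i_1$ others blue. (In general, $X$ and $Y$ are not independent.) -/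

import Mathlib

/-! ### A fragment of the Java Virtual Machine

Integer variables hold unbounded integers (there is no overflow), and there is one `int[]` object
on the heap, to which array references point. -/

namespace Jvm

/-- Contents of a local variable or of a slot of the operand stack: an `int` or a reference to the
(only) array. -/
inductive Val where
  | int (z : ℤ)
  | ref

/-- Bytecode instructions, named as in the JVM specification. Operands `v` are numbers of local
variables; jump targets are positions in the code. -/
inductive Instr where
  /-- push the `int` variable `v` -/
  | iload (v : ℕ)
  /-- pop an `int` and store it in variable `v` -/
  | istore (v : ℕ)
  /-- push the array reference in variable `v` -/
  | aload (v : ℕ)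
  /-- pop index and reference, push the array entry -/
  | iaload
  /-- pop value, index and reference, write the value into the array -/
  | iastore
  /-- add the constant `c` to the `int` variable `v` -/
  | iinc (v : ℕ) (c : ℤ)
  /-- jump -/
  | goto (target : ℕ)
  /-- pop `y`, then `x`; jump if `x < y` -/
  | if_icmplt (target : ℕ)
  /-- pop `y`, then `x`; jump if `x ≤ y` -/
  | if_icmple (target : ℕ)
  /-- pop `y`, then `x`; jump if `x > y` -/
  | if_icmpgt (target : ℕ)
  /-- pop `y`, then `x`; jump if `x ≥ y` -/
  | if_icmpge (target : ℕ)

/-- A machine state. Of `cells`, only the entries with index `< length` are part of the array. -/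
structure State where
  pc : ℕ
  stack : List Val
  locals : ℕ → Val
  length : ℕ
  cells : ℕ → ℤ

/-- A conditional jump that compares the two topmost `int`s on the stack. -/
def State.branch (s : State) (cmp : ℤ → ℤ → Bool) (target : ℕ) : Option State :=
  match s.stack with
  | Val.int y :: Val.int x :: st =>
      some { s with pc := if cmp x y then target else s.pc + 1, stack := st }
  | _ => none

/-- Effect of one instruction. The result is `none` if operands have the wrong type, if the stack
underflows, or if an array index is out of bounds. -/
def Instr.exec (i : Instr) (s : State) : Option State :=
  match i with
  | iload v =>
      match s.locals v with
      | Val.int z => some { s with pc := s.pc + 1, stack := Val.int z :: s.stack }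
      | Val.ref => none
  | istore v =>
      match s.stack with
      | Val.int z :: st =>
          some { s with pc := s.pc + 1, stack := st,
                        locals := Function.update s.locals v (Val.int z) }
      | _ => none
  | aload v =>
      match s.locals v with
      | Val.ref => some { s with pc := s.pc + 1, stack := Val.ref :: s.stack }
      | Val.int _ => none
  | iaload =>
      match s.stack with
      | Val.int j :: Val.ref :: st =>
          if 0 ≤ j ∧ j < s.length then
            some { s with pc := s.pc + 1, stack := Val.int (s.cells j.toNat) :: st }
          else none
      | _ => none
  | iastore =>
      match s.stack with
      | Val.int z :: Val.int j :: Val.ref :: st =>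
          if 0 ≤ j ∧ j < s.length then
            some { s with pc := s.pc + 1, stack := st,
                          cells := Function.update s.cells j.toNat z }
          else none
      | _ => none
  | iinc v c =>
      match s.locals v with
      | Val.int z =>
          some { s with pc := s.pc + 1,
                        locals := Function.update s.locals v (Val.int (z + c)) }
      | Val.ref => none
  | goto target => some { s with pc := target }
  | if_icmplt target => s.branch (fun x y => decide (x < y)) target
  | if_icmple target => s.branch (fun x y => decide (x ≤ y)) target
  | if_icmpgt target => s.branch (fun x y => decide (y < x)) target
  | if_icmpge target => s.branch (fun x y => decide (y ≤ x)) target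

/-- Execute the instruction of `code` at the current position. -/
def step (code : List Instr) (s : State) : Option State :=
  (code[s.pc]?).bind fun i => i.exec s

/-- `Runs code s N s'`: started in `s`, the code executes exactly `N` instructions until control
reaches the end of the code, and the state is then `s'`. -/
inductive Runs (code : List Instr) : State → ℕ → State → Prop where
  | done (s : State) (h : s.pc = code.length) : Runs code s 0 s
  | step {s s₁ s₂ : State} {N : ℕ} (h : Jvm.step code s = some s₁) (hr : Runs code s₁ N s₂) :
      Runs code s (N + 1) s₂

end Jvm

/-! ### The partitioning method -/

namespace Yaroslavskiy

/-- Local variable `int[] A`. -/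
abbrev vA : ℕ := 0
/-- Local variable `int left`, the first position of the range to be partitioned. -/
abbrev vLeft : ℕ := 1
/-- Local variable `int right`, the last position of the range to be partitioned. -/
abbrev vRight : ℕ := 2
/-- Local variable `int p`, the smaller pivot. -/
abbrev vP : ℕ := 3
/-- Local variable `int q`, the larger pivot. -/
abbrev vQ : ℕ := 4
/-- Local variable `int l`. -/
abbrev vL : ℕ := 5
/-- Local variable `int g`. -/
abbrev vG : ℕ := 6
/-- Local variable `int k`. -/
abbrev vK : ℕ := 7
/-- Local variable `int ak`. -/
abbrev vAk : ℕ := 8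
/-- Local variable `int ag`. -/
abbrev vAg : ℕ := 9

open Jvm.Instr in
/-- The Bytecode of
```
int l = left, g = right, k = l;
while (k <= g) {
  final int ak = A[k];
  if (ak < p) {
    A[k] = A[l]; A[l] = ak; ++l;
  } else if (ak >= q) {
    while (A[g] > q && k < g) --g;
    final int ag = A[g];
    if (ag < p) {
      A[k] = A[l]; A[l] = ag; ++l;
    } else {
      A[k] = ag;
    }
    A[g] = ak; --g;
  }
  ++k;
}
--l; ++g;
```
-/
def partitionCode : List Jvm.Instr :=
  [ -- 0: l = left; g = right; k = l
    iload vLeft, istore vL, iload vRight, istore vG, iload vL, istore vK,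
    -- 6: while (k <= g)
    iload vK, iload vG, if_icmpgt 71,
    -- 9: ak = A[k]
    aload vA, iload vK, iaload, istore vAk,
    -- 13: if (ak < p)
    iload vAk, iload vP, if_icmpge 28,
    -- 16: A[k] = A[l]
    aload vA, iload vK, aload vA, iload vL, iaload, iastore,
    -- 22: A[l] = ak; ++l
    aload vA, iload vL, iload vAk, iastore, iinc vL 1, goto 69,
    -- 28: else if (ak >= q)
    iload vAk, iload vQ, if_icmplt 69,
    -- 31: while (A[g] > q && k < g) --g
    aload vA, iload vG, iaload, iload vQ, if_icmple 41,
    iload vK, iload vG, if_icmpge 41, iinc vG (-1), goto 31,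
    -- 41: ag = A[g]
    aload vA, iload vG, iaload, istore vAg,
    -- 45: if (ag < p)
    iload vAg, iload vP, if_icmpge 60,
    -- 48: A[k] = A[l]
    aload vA, iload vK, aload vA, iload vL, iaload, iastore,
    -- 54: A[l] = ag; ++l
    aload vA, iload vL, iload vAg, iastore, iinc vL 1, goto 64,
    -- 60: else A[k] = ag
    aload vA, iload vK, iload vAg, iastore,
    -- 64: A[g] = ak; --g
    aload vA, iload vG, iload vAk, iastore, iinc vG (-1),
    -- 69: ++k
    iinc vK 1, goto 6,
    -- 71: --l; ++g
    iinc vL (-1), iinc vG 1 ]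

/-- Size of the sample for the pivot sampling parameter `(t₁, t₂, t₃)`. -/
def sampleSize (t₁ t₂ t₃ : ℕ) : ℕ := t₁ + t₂ + t₃ + 2

section
variable (t₁ t₂ t₃ : ℕ) {n : ℕ}

/-- The sample: the `t₁ + t₂ + 1` leftmost and the `t₃ + 1` rightmost positions of the array
(positions are numbered from `0`). -/
def samplePositions (n : ℕ) : Finset (Fin n) :=
  Finset.univ.filter fun j => (j : ℕ) < t₁ + t₂ + 1 ∨ n ≤ (j : ℕ) + t₃ + 1

/-- The positions of the ordinary elements. -/
def ordinaryPositions (n : ℕ) : Finset (Fin n) := (samplePositions t₁ t₂ t₃ n)ᶜ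

/-- The sample in increasing order. -/
def sortedSample (a : Fin n → ℤ) : List ℤ :=
  ((samplePositions t₁ t₂ t₃ n).val.map a).sort (· ≤ ·)

/-- The smaller pivot, the sample element of rank `t₁ + 1`. -/
def pivotP (a : Fin n → ℤ) : ℤ := (sortedSample t₁ t₂ t₃ a).getD t₁ 0

/-- The larger pivot, the sample element of rank `t₁ + t₂ + 2`. -/
def pivotQ (a : Fin n → ℤ) : ℤ := (sortedSample t₁ t₂ t₃ a).getD (t₁ + t₂ + 1) 0

/-- The numbers of small, medium and large ordinary elements. -/
def partitionSizes (a : Fin n → ℤ) : ℕ × ℕ × ℕ :=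
  (((ordinaryPositions t₁ t₂ t₃ n).filter fun j => a j < pivotP t₁ t₂ t₃ a).card,
   ((ordinaryPositions t₁ t₂ t₃ n).filter fun j =>
      pivotP t₁ t₂ t₃ a < a j ∧ a j < pivotQ t₁ t₂ t₃ a).card,
   ((ordinaryPositions t₁ t₂ t₃ n).filter fun j => pivotQ t₁ t₂ t₃ a < a j).card)

/-- The array after the sample has been sorted (jumping over the gap between its two parts);
ordinary elements have not been moved. -/
def sampleSortedArray (a : Fin n → ℤ) (j : ℕ) : ℤ :=
  if j < t₁ + t₂ + 1 then (sortedSample t₁ t₂ t₃ a).getD j 0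
  else if n ≤ j + t₃ + 1 then
    (sortedSample t₁ t₂ t₃ a).getD (j - (n - sampleSize t₁ t₂ t₃)) 0
  else if h : j < n then a ⟨j, h⟩ else 0

/-- The machine state in which partitioning of the ordinary elements starts. -/
def partitionStart (a : Fin n → ℤ) : Jvm.State where
  pc := 0
  stack := []
  locals := fun v =>
    if v = vA then Jvm.Val.ref
    else if v = vLeft then Jvm.Val.int (t₁ + t₂ + 1)
    else if v = vRight then Jvm.Val.int (n - t₃ - 2)
    else if v = vP then Jvm.Val.int (pivotP t₁ t₂ t₃ a)
    else if v = vQ then Jvm.Val.int (pivotQ t₁ t₂ t₃ a)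
    else Jvm.Val.int 0
  length := n
  cells := sampleSortedArray t₁ t₂ t₃ a

/-- `PartitionBytecodes t₁ t₂ t₃ a N`: in the first partitioning step on the input array `a`,
partitioning terminates normally after executing exactly `N` Bytecode instructions. -/
def PartitionBytecodes (a : Fin n → ℤ) (N : ℕ) : Prop :=
  ∃ s, Jvm.Runs partitionCode (partitionStart t₁ t₂ t₃ a) N s

end

/-! ### Probability -/

/-- The input array that holds the permutation `σ`. -/
def permArray {n : ℕ} (σ : Equiv.Perm (Fin n)) (j : Fin n) : ℤ := ((σ j : ℕ) : ℤ)

/-- The law of a uniformly random permutation of size `n` conditional on the partition sizes being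
`i`, where `i` has positive probability. -/
noncomputable def permGivenSizes (t₁ t₂ t₃ n : ℕ) (i : ℕ × ℕ × ℕ)
    (hi : ∃ σ : Equiv.Perm (Fin n), partitionSizes t₁ t₂ t₃ (permArray σ) = i) :
    PMF (Equiv.Perm (Fin n)) :=
  (PMF.uniformOfFintype (Equiv.Perm (Fin n))).filter
    {σ | partitionSizes t₁ t₂ t₃ (permArray σ) = i}
    (by
      obtain ⟨σ, hσ⟩ := hi
      exact ⟨σ, hσ, by simp⟩)

/-- The set of balls obtained by drawing `k` times without replacement from an urn with the balls
`0, …, n - 1` (until the urn is empty, should `k` exceed `n`). -/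
noncomputable def draw (k n : ℕ) : PMF (Finset (Fin n)) :=
  PMF.uniformOfFinset (Finset.powersetCard (min k n) Finset.univ)
    (Finset.powersetCard_nonempty.2 (by simp))

/-- The hypergeometric distribution: the number of red balls when drawing `k` times without
replacement from an urn of `n` balls, `r` of which (here the first `r`) are red. -/
noncomputable def hypergeometric (k r n : ℕ) : PMF ℕ :=
  (draw k n).map fun s => (s.filter fun b : Fin n => (b : ℕ) < r).card

/-- The joint law of the numbers of red and of blue balls when drawing `k` times without replacement
from an urn of `n` balls, of which `r` (here the first `r`) are red and `b` others (here the last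
`b`) are blue; meant for `r + b ≤ n`. -/
noncomputable def hypergeometricPair (k r b n : ℕ) : PMF (ℕ × ℕ) :=
  (draw k n).map fun s =>
    ((s.filter fun x : Fin n => (x : ℕ) < r).card,
     (s.filter fun x : Fin n => n ≤ (x : ℕ) + b).card)

end Yaroslavskiy

/-! The bytecode is executed symbolically, one straight-line block at a time. In this way every
element acquires a fixed cost, depending on its class and on which scan meets it. The scan from the
left and the scan from the right meet at a crossing point. Each large element left of it is swapped
with a small or medium element right of it, with at most one left over, so left of the crossing
point lie about I₁ + I₂ elements.

`LoopCost` charges 24, 15, 32 to small, medium, large elements left of the crossing point and 12, 4,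
10 to those right of it. Over the base rate 10 the surplus is 14, 5, 22 on the left and 2, -6, 0 on
the right. By the balance of swaps, 11 of the 22 can be moved from each large element on the left to
its small or medium partner, which then has surplus 13 or 5. This leaves 13 per small, 5 per medium,
11 per large on the left and 1 more per small on the left, up to O(1) (`LoopCost.abs_sub_le`).

So X and Y can be the numbers of large and small elements among the first I₁ + I₂ ordinary ones.
Permuting the ordinary elements changes neither pivots nor sizes, so the conditional law is
invariant and may be averaged over such permutations (`pmf_map_eq_of_invariant`). For a fixed input,
the head then becomes a uniformly random subset of an urn coloured by class
(`map_head_eq_hypergeometricPair`). -/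

namespace Yaroslavskiy

open Jvm

/-! ### Symbolic execution of the bytecode -/

/-- Local variables of the partitioning method. -/
def frame (left right p q l g k ak ag : ℤ) : ℕ → Val
  | 0 => .ref
  | 1 => .int left
  | 2 => .int right
  | 3 => .int p
  | 4 => .int q
  | 5 => .int l
  | 6 => .int g
  | 7 => .int k
  | 8 => .int ak
  | 9 => .int ag
  | _ => .int 0

section frame
variable (left right p q l g k ak ag z : ℤ)

-- Each store brings the locals back to the form `frame …`, so updates do not pile up during
-- symbolic execution.
@[simp]
theorem update_frame_l : Function.update (frame left right p q l g k ak ag) 5 (.int z) =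
    frame left right p q z g k ak ag := by
  funext v
  rcases v with _ | _ | _ | _ | _ | _ | _ | _ | _ | _ | v <;> rfl

@[simp]
theorem update_frame_g : Function.update (frame left right p q l g k ak ag) 6 (.int z) =
    frame left right p q l z k ak ag := by
  funext v
  rcases v with _ | _ | _ | _ | _ | _ | _ | _ | _ | _ | v <;> rfl

@[simp]
theorem update_frame_k : Function.update (frame left right p q l g k ak ag) 7 (.int z) =
    frame left right p q l g z ak ag := by
  funext v
  rcases v with _ | _ | _ | _ | _ | _ | _ | _ | _ | _ | v <;> rfl

@[simp]
theorem update_frame_ak : Function.update (frame left right p q l g k ak ag) 8 (.int z) =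
    frame left right p q l g k z ag := by
  funext v
  rcases v with _ | _ | _ | _ | _ | _ | _ | _ | _ | _ | v <;> rfl

@[simp]
theorem update_frame_ag : Function.update (frame left right p q l g k ak ag) 9 (.int z) =
    frame left right p q l g k ak z := by
  funext v
  rcases v with _ | _ | _ | _ | _ | _ | _ | _ | _ | _ | v <;> rfl

end frame

section blocks
variable {left right p q l g k ak ag : ℤ} {n : ℕ} {c : ℕ → ℤ} {N : ℕ} {s' : State}

theorem runs_partitionStart
    (h : Runs partitionCode ⟨6, [], frame left right p q left right left ak ag, n, c⟩ N s') :
    Runs partitionCode ⟨0, [], frame left right p q l g k ak ag, n, c⟩ (N + 6) s' := by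
  -- Each round executes one instruction; the successor state is a metavariable that `rfl` fills
  -- with the result of `simp`.
  iterate 6 refine .step (by simp [step, partitionCode, Instr.exec, State.branch, frame, *]; rfl) ?_
  exact h

theorem runs_loop_exit (hgk : g < k) :
    Runs partitionCode ⟨6, [], frame left right p q l g k ak ag, n, c⟩ 5
      ⟨73, [], frame left right p q (l - 1) (g + 1) k ak ag, n, c⟩ := by
  iterate 5 refine .step (by simp [step, partitionCode, Instr.exec, State.branch, frame, *]; rfl) ?_
  exact .done _ rfl

theorem runs_loop_small (hkg : k ≤ g) (hk : 0 ≤ k ∧ k < n) (hl : 0 ≤ l ∧ l < n)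
    (hp : c k.toNat < p)
    (h : Runs partitionCode ⟨6, [], frame left right p q (l + 1) g (k + 1) (c k.toNat) ag, n,
      Function.update (Function.update c k.toNat (c l.toNat)) l.toNat (c k.toNat)⟩ N s') :
    Runs partitionCode ⟨6, [], frame left right p q l g k ak ag, n, c⟩ (N + 24) s' := by
  have h1 : ¬ g < k := by omega
  have h2 : ¬ p ≤ c k.toNat := by omega
  iterate 24 refine .step (by simp [step, partitionCode, Instr.exec, State.branch, frame, *]; rfl) ?_
  exact h

theorem runs_loop_medium (hkg : k ≤ g) (hk : 0 ≤ k ∧ k < n)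
    (hp : p ≤ c k.toNat) (hq : c k.toNat < q)
    (h : Runs partitionCode ⟨6, [], frame left right p q l g (k + 1) (c k.toNat) ag, n, c⟩ N s') :
    Runs partitionCode ⟨6, [], frame left right p q l g k ak ag, n, c⟩ (N + 15) s' := by
  have h1 : ¬ g < k := by omega
  iterate 15 refine .step (by simp [step, partitionCode, Instr.exec, State.branch, frame, *]; rfl) ?_
  exact h

/-- The block stops at instruction 31, the head of the inner loop, because that loop needs an
induction of its own. -/
theorem runs_loop_large (hkg : k ≤ g) (hk : 0 ≤ k ∧ k < n)
    (hp : p ≤ c k.toNat) (hq : q ≤ c k.toNat)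
    (h : Runs partitionCode ⟨31, [], frame left right p q l g k (c k.toNat) ag, n, c⟩ N s') :
    Runs partitionCode ⟨6, [], frame left right p q l g k ak ag, n, c⟩ (N + 13) s' := by
  have h1 : ¬ g < k := by omega
  have h2 : ¬ c k.toNat < q := by omega
  iterate 13 refine .step (by simp [step, partitionCode, Instr.exec, State.branch, frame, *]; rfl) ?_
  exact h

theorem runs_scan_large (hkg : k < g) (hg : 0 ≤ g ∧ g < n) (hq : q < c g.toNat)
    (h : Runs partitionCode ⟨31, [], frame left right p q l (g - 1) k ak ag, n, c⟩ N s') :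
    Runs partitionCode ⟨31, [], frame left right p q l g k ak ag, n, c⟩ (N + 10) s' := by
  have h1 : ¬ g ≤ k := by omega
  have h2 : ¬ c g.toNat ≤ q := by omega
  iterate 10 refine .step (by simp [step, partitionCode, Instr.exec, State.branch, frame, *]; rfl) ?_
  exact h

/-- The scan from the right stops because it has met the scan from the left, in a large element. -/
theorem runs_scan_meet (hg : 0 ≤ g ∧ g < n) (hp : p ≤ c g.toNat) (hq : q < c g.toNat)
    (h : Runs partitionCode ⟨6, [], frame left right p q l (g + -1) (g + 1) ak (c g.toNat), n,
      Function.update c g.toNat ak⟩ N s') :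
    Runs partitionCode ⟨31, [], frame left right p q l g g ak ag, n, c⟩ (N + 26) s' := by
  have h2 : ¬ c g.toNat ≤ q := by omega
  iterate 26 refine .step (by simp [step, partitionCode, Instr.exec, State.branch, frame, *]; rfl) ?_
  exact h

theorem runs_scan_small (hg : 0 ≤ g ∧ g < n) (hk : 0 ≤ k ∧ k < n) (hl : 0 ≤ l ∧ l < n)
    (hp : c g.toNat < p) (hq : c g.toNat ≤ q)
    (h : Runs partitionCode ⟨6, [], frame left right p q (l + 1) (g - 1) (k + 1) ak (c g.toNat), n,
      Function.update (Function.update (Function.update c k.toNat (c l.toNat))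
        l.toNat (c g.toNat)) g.toNat ak⟩ N s') :
    Runs partitionCode ⟨31, [], frame left right p q l g k ak ag, n, c⟩ (N + 31) s' := by
  have h1 : ¬ p ≤ c g.toNat := by omega
  iterate 31 refine .step (by simp [step, partitionCode, Instr.exec, State.branch, frame, *]; rfl) ?_
  exact h

theorem runs_scan_medium (hg : 0 ≤ g ∧ g < n) (hk : 0 ≤ k ∧ k < n)
    (hp : p ≤ c g.toNat) (hq : c g.toNat ≤ q)
    (h : Runs partitionCode ⟨6, [], frame left right p q l (g - 1) (k + 1) ak (c g.toNat), n,
      Function.update (Function.update c k.toNat (c g.toNat)) g.toNat ak⟩ N s') :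
    Runs partitionCode ⟨31, [], frame left right p q l g k ak ag, n, c⟩ (N + 23) s' := by
  iterate 23 refine .step (by simp [step, partitionCode, Instr.exec, State.branch, frame, *]; rfl) ?_
  exact h

end blocks

/-! ### Counting entries of a class in a range -/

/-- The number of positions in `[a, b)` whose entry satisfies `S`. -/
noncomputable def countIn (c : ℕ → ℤ) (S : Set ℤ) (a b : ℕ) : ℕ :=
  ({j | a ≤ j ∧ j < b ∧ c j ∈ S} : Set ℕ).ncard

section countIn
variable {c c' : ℕ → ℤ} {S : Set ℤ} {a b d : ℕ}

theorem finite_countIn (c : ℕ → ℤ) (S : Set ℤ) (a b : ℕ) :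
    ({j | a ≤ j ∧ j < b ∧ c j ∈ S} : Set ℕ).Finite :=
  (Set.finite_Iio b).subset fun _ h => h.2.1

theorem countIn_congr (h : ∀ j, a ≤ j → j < b → c j = c' j) :
    countIn c S a b = countIn c' S a b := by
  unfold countIn
  congr 1
  ext j
  simp only [Set.mem_ofPred_eq]
  refine and_congr_right fun h1 => and_congr_right fun h2 => ?_
  rw [h j h1 h2]

theorem countIn_self : countIn c S a a = 0 := by
  have : ({j | a ≤ j ∧ j < a ∧ c j ∈ S} : Set ℕ) = ∅ := by
    ext j; simp only [Set.mem_ofPred_eq, Set.mem_empty_iff_false, iff_false]; omega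
  rw [countIn, this, Set.ncard_empty]

theorem countIn_add (hab : a ≤ b) (hbd : b ≤ d) :
    countIn c S a b + countIn c S b d = countIn c S a d := by
  unfold countIn
  rw [← Set.ncard_union_eq ?_ (finite_countIn ..) (finite_countIn ..)]
  · congr 1
    ext j
    simp only [Set.mem_union, Set.mem_ofPred_eq]
    constructor
    · rintro (⟨h1, h2, h3⟩ | ⟨h1, h2, h3⟩)
      · exact ⟨h1, by omega, h3⟩
      · exact ⟨by omega, h2, h3⟩
    · rintro ⟨h1, h2, h3⟩
      rcases lt_or_ge j b with h | h
      · exact .inl ⟨h1, h, h3⟩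
      · exact .inr ⟨h, h2, h3⟩
  · rw [Set.disjoint_left]
    rintro j ⟨_, h, _⟩ ⟨h', _, _⟩
    omega

theorem countIn_one_of_mem (h : c a ∈ S) : countIn c S a (a + 1) = 1 := by
  have : ({j | a ≤ j ∧ j < a + 1 ∧ c j ∈ S} : Set ℕ) = {a} := by
    ext j
    simp only [Set.mem_ofPred_eq, Set.mem_singleton_iff]
    constructor
    · rintro ⟨h1, h2, _⟩; omega
    · rintro rfl; exact ⟨le_rfl, by omega, h⟩
  rw [countIn, this, Set.ncard_singleton]

theorem countIn_one_of_notMem (h : c a ∉ S) : countIn c S a (a + 1) = 0 := by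
  have : ({j | a ≤ j ∧ j < a + 1 ∧ c j ∈ S} : Set ℕ) = ∅ := by
    ext j
    simp only [Set.mem_ofPred_eq, Set.mem_empty_iff_false, iff_false]
    rintro ⟨h1, h2, h3⟩
    obtain rfl : j = a := by omega
    exact h h3
  rw [countIn, this, Set.ncard_empty]

theorem countIn_head (hab : a < b) :
    countIn c S a b = countIn c S a (a + 1) + countIn c S (a + 1) b :=
  (countIn_add (by omega) (by omega)).symm

theorem countIn_last (hab : a ≤ b) :
    countIn c S a (b + 1) = countIn c S a b + countIn c S b (b + 1) :=
  (countIn_add hab (by omega)).symm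

theorem countIn_le : countIn c S a b ≤ b - a := by
  have : ({j | a ≤ j ∧ j < b ∧ c j ∈ S} : Set ℕ) ⊆ Set.Ico a b := fun j h => ⟨h.1, h.2.1⟩
  calc countIn c S a b ≤ (Set.Ico a b).ncard := Set.ncard_le_ncard this (Set.finite_Ico a b)
    _ = b - a := by rw [Set.ncard_eq_toFinset_card']; simp

end countIn

/-- The sizes of the classes of small, medium and large entries of `[a, b)` add up. -/
theorem countIn_classes {c : ℕ → ℤ} {p q : ℤ} {a b : ℕ} (hpq : p ≤ q) (hab : a ≤ b)
    (hc : ∀ j, a ≤ j → j < b → c j ≠ p ∧ c j ≠ q) :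
    countIn c (Set.Iio p) a b + countIn c (Set.Ioo p q) a b + countIn c (Set.Ioi q) a b = b - a := by
  induction b, hab using Nat.le_induction with
  | base => simp [countIn_self]
  | succ b hab ih =>
    have ih := ih fun j h1 h2 => hc j h1 (by omega)
    obtain ⟨hp, hq⟩ := hc b hab (by omega)
    rw [countIn_last hab, countIn_last hab, countIn_last hab]
    rcases lt_or_gt_of_ne hp with hp | hp
    · rw [countIn_one_of_mem (S := Set.Iio p) hp,
        countIn_one_of_notMem (S := Set.Ioo p q) (by simp; omega),
        countIn_one_of_notMem (S := Set.Ioi q) (by simp; omega)]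
      omega
    · rcases lt_or_gt_of_ne hq with hq | hq
      · rw [countIn_one_of_notMem (S := Set.Iio p) (by simp; omega),
          countIn_one_of_mem (S := Set.Ioo p q) ⟨hp, hq⟩,
          countIn_one_of_notMem (S := Set.Ioi q) (by simp; omega)]
        omega
      · rw [countIn_one_of_notMem (S := Set.Iio p) (by simp; omega),
          countIn_one_of_notMem (S := Set.Ioo p q) (by simp; omega),
          countIn_one_of_mem (S := Set.Ioi q) hq]
        omega

/-! ### Cost of a range in terms of its crossing point -/

/-- `LoopCost c p q k e N`: for the range `[k, e)` of `c`, there is a crossing point such that `N`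
is, up to a bounded error, the cost of scanning the range before it from the left and the range
after it from the right. -/
def LoopCost (c : ℕ → ℤ) (p q : ℤ) (k e N : ℕ) : Prop :=
  ∃ x δ ε, k ≤ x ∧ x ≤ e ∧ δ ≤ 1 ∧ ε ≤ 12 ∧
    countIn c (Set.Ioi q) k x = countIn c (Set.Iio p) x e + countIn c (Set.Ioo p q) x e + δ ∧
    N = 24 * countIn c (Set.Iio p) k x + 15 * countIn c (Set.Ioo p q) k x +
      32 * countIn c (Set.Ioi q) k x + 12 * countIn c (Set.Iio p) x e +
      4 * countIn c (Set.Ioo p q) x e + 10 * countIn c (Set.Ioi q) x e + 5 + ε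

section LoopCost
variable {c c' : ℕ → ℤ} {p q : ℤ} {k e N : ℕ}

theorem loopCost_empty : LoopCost c p q k k 5 :=
  ⟨k, 0, 0, le_rfl, le_rfl, by omega, by omega, by simp [countIn_self], by simp [countIn_self]⟩

/-- Needed because swaps overwrite cells outside the part of the range that is still to be scanned.
-/
theorem LoopCost.congr (h : LoopCost c p q k e N) (hc : ∀ j, k ≤ j → j < e → c j = c' j) :
    LoopCost c' p q k e N := by
  obtain ⟨x, δ, ε, h1, h2, h3⟩ := h
  have hl : ∀ S, countIn c S k x = countIn c' S k x := fun S =>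
    countIn_congr fun j _ _ => hc j (by omega) (by omega)
  have hr : ∀ S, countIn c S x e = countIn c' S x e := fun S =>
    countIn_congr fun j _ _ => hc j (by omega) (by omega)
  simp only [hl, hr] at h3
  exact ⟨x, δ, ε, h1, h2, h3⟩

theorem LoopCost.small (h : LoopCost c p q (k + 1) e N) (hpq : p ≤ q) (hp : c k < p) :
    LoopCost c p q k e (N + 24) := by
  obtain ⟨x, δ, ε, h1, h2, h3, h4, h5, h6⟩ := h
  refine ⟨x, δ, ε, by omega, h2, h3, h4, ?_⟩
  rw [countIn_head (S := Set.Iio p) (a := k) (b := x) (by omega),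
    countIn_head (S := Set.Ioo p q) (a := k) (b := x) (by omega),
    countIn_head (S := Set.Ioi q) (a := k) (b := x) (by omega), countIn_one_of_mem (S := Set.Iio p) hp,
    countIn_one_of_notMem (S := Set.Ioo p q) (by simp; omega),
    countIn_one_of_notMem (S := Set.Ioi q) (by simp; omega)]
  omega

theorem LoopCost.medium (h : LoopCost c p q (k + 1) e N) (hp : p < c k) (hq : c k < q) :
    LoopCost c p q k e (N + 15) := by
  obtain ⟨x, δ, ε, h1, h2, h3, h4, h5, h6⟩ := h
  refine ⟨x, δ, ε, by omega, h2, h3, h4, ?_⟩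
  rw [countIn_head (S := Set.Iio p) (a := k) (b := x) (by omega),
    countIn_head (S := Set.Ioo p q) (a := k) (b := x) (by omega),
    countIn_head (S := Set.Ioi q) (a := k) (b := x) (by omega), countIn_one_of_notMem (S := Set.Iio p) (by simp; omega),
    countIn_one_of_mem (S := Set.Ioo p q) ⟨hp, hq⟩,
    countIn_one_of_notMem (S := Set.Ioi q) (by simp; omega)]
  omega

/-- A swap adds one entry to each side of the balance equation. Its cost 44 = 13 + 31 is split as 32
+ 12; with a medium partner, 36 = 13 + 23 is split as 32 + 4. -/
theorem LoopCost.large_small (h : LoopCost c p q (k + 1) e N) (hpq : p ≤ q) (hk : q < c k)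
    (he : c e < p) : LoopCost c p q k (e + 1) (N + 44) := by
  obtain ⟨x, δ, ε, h1, h2, h3, h4, h5, h6⟩ := h
  refine ⟨x, δ, ε, by omega, by omega, h3, h4, ?_⟩
  rw [countIn_head (S := Set.Iio p) (a := k) (b := x) (by omega),
    countIn_head (S := Set.Ioo p q) (a := k) (b := x) (by omega),
    countIn_head (S := Set.Ioi q) (a := k) (b := x) (by omega), countIn_one_of_notMem (S := Set.Iio p) (by simp; omega),
    countIn_one_of_notMem (S := Set.Ioo p q) (by simp; omega),
    countIn_one_of_mem (S := Set.Ioi q) hk,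
    countIn_last (S := Set.Iio p) h2, countIn_last (S := Set.Ioo p q) h2,
    countIn_last (S := Set.Ioi q) h2, countIn_one_of_mem (S := Set.Iio p) he,
    countIn_one_of_notMem (S := Set.Ioo p q) (by simp; omega),
    countIn_one_of_notMem (S := Set.Ioi q) (by simp; omega)]
  omega

theorem LoopCost.large_medium (h : LoopCost c p q (k + 1) e N) (hpq : p ≤ q) (hk : q < c k)
    (hp : p < c e) (hq : c e < q) : LoopCost c p q k (e + 1) (N + 36) := by
  obtain ⟨x, δ, ε, h1, h2, h3, h4, h5, h6⟩ := h
  refine ⟨x, δ, ε, by omega, by omega, h3, h4, ?_⟩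
  rw [countIn_head (S := Set.Iio p) (a := k) (b := x) (by omega),
    countIn_head (S := Set.Ioo p q) (a := k) (b := x) (by omega),
    countIn_head (S := Set.Ioi q) (a := k) (b := x) (by omega), countIn_one_of_notMem (S := Set.Iio p) (by simp; omega),
    countIn_one_of_notMem (S := Set.Ioo p q) (by simp; omega),
    countIn_one_of_mem (S := Set.Ioi q) hk,
    countIn_last (S := Set.Iio p) h2, countIn_last (S := Set.Ioo p q) h2,
    countIn_last (S := Set.Ioi q) h2,
    countIn_one_of_notMem (S := Set.Iio p) (by simp; omega),
    countIn_one_of_mem (S := Set.Ioo p q) ⟨hp, hq⟩,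
    countIn_one_of_notMem (S := Set.Ioi q) (by simp; omega)]
  omega

/-- The last large entry has no partner: it is swapped with itself, and then the loop ends. This
costs 13 + 26 + 5 = 44 = 32 + 5 + 7, whence δ = 1 and ε = 7. -/
theorem loopCost_single (hpq : p ≤ q) (hk : q < c k) : LoopCost c p q k (k + 1) 44 := by
  refine ⟨k + 1, 1, 7, by omega, by omega, le_rfl, by omega, ?_⟩
  rw [countIn_one_of_notMem (S := Set.Iio p) (by simp; omega),
    countIn_one_of_notMem (S := Set.Ioo p q) (by simp; omega),
    countIn_one_of_mem (S := Set.Ioi q) hk]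
  simp [countIn_self]

/-- A large entry met by the scan from the right before the crossing point costs `10`. -/
theorem LoopCost.scan_large (h : LoopCost c p q k e N) (hpq : p ≤ q) (he : q < c e) : LoopCost c p q k (e + 1) (N + 10) := by
  obtain ⟨x, δ, ε, h1, h2, h3, h4, h5, h6⟩ := h
  refine ⟨x, δ, ε, by omega, by omega, h3, h4, ?_⟩
  rw [countIn_last (S := Set.Iio p) h2, countIn_last (S := Set.Ioo p q) h2,
    countIn_last (S := Set.Ioi q) h2,
    countIn_one_of_notMem (S := Set.Iio p) (by simp; omega),
    countIn_one_of_notMem (S := Set.Ioo p q) (by simp; omega),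
    countIn_one_of_mem (S := Set.Ioi q) he]
  omega

end LoopCost

/-! ### Termination and cost of the loops -/

/-- The inner loop is handled by induction on the right end `e`, with the outer loop on shorter
ranges supplied as `ih`. The summand 13 accounts for the instructions that precede the inner loop in
the same iteration. -/
theorem exists_runs_scan {left right p q : ℤ} {n : ℕ} (hpq : p ≤ q) {c : ℕ → ℤ} {l k e : ℕ}
    {ag : ℤ} (hl : l ≤ k) (hke : k < e) (hen : e ≤ n)
    (hc : ∀ j, k ≤ j → j < e → c j ≠ p ∧ c j ≠ q) (hk : q < c k)
    (ih : ∀ (c' : ℕ → ℤ) (l' e' : ℕ) (ak ag : ℤ), l' ≤ k + 1 → k + 1 ≤ e' → e' ≤ n → e' < e →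
      (∀ j, k + 1 ≤ j → j < e' → c' j = c j) →
      ∃ N s', Runs partitionCode
        ⟨6, [], frame left right p q l' ((e' : ℤ) - 1) ((k + 1 : ℕ) : ℤ) ak ag, n, c'⟩ N s' ∧
        LoopCost c' p q (k + 1) e' N) :
    ∃ N s', Runs partitionCode
      ⟨31, [], frame left right p q l ((e : ℤ) - 1) k (c k) ag, n, c⟩ N s' ∧
      LoopCost c p q k e (N + 13) := by
  induction e, hke using Nat.le_induction generalizing ag with
  | base =>
    have := runs_scan_meet (left := left) (right := right) (p := p) (q := q) (l := l) (g := k)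
      (ak := c k) (ag := ag) (n := n) (c := c) (N := 5) ⟨by omega, by omega⟩
      (by simp; omega) (by simpa using hk) (runs_loop_exit (by omega))
    exact ⟨5 + 26, _, by simpa using this, loopCost_single hpq hk⟩
  | succ e hke ihe =>
    obtain ⟨hp, hq⟩ := hc e (by omega) (by omega)
    rcases lt_or_gt_of_ne hq with hq | hq
    · rcases lt_or_gt_of_ne hp with hp | hp
      -- The rotation writes to `k`, `l ≤ k` and `e`, all outside the remaining range `[k + 1, e)`.
      · obtain ⟨N, s', hr, hN⟩ := ih
          (Function.update (Function.update (Function.update c k (c l)) l (c e)) e (c k)) (l + 1) e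
          (c k) (c e) (by omega) hke (by omega) (by omega)
          (fun j h1 h2 => by
            rw [Function.update_of_ne (by omega), Function.update_of_ne (by omega),
              Function.update_of_ne (by omega)])
        refine ⟨N + 31, s', ?_, ?_⟩
        · have := runs_scan_small (left := left) (right := right) (p := p) (q := q) (l := l)
            (g := e) (k := k) (ak := c k) (ag := ag) (n := n) (c := c) (N := N) (s' := s')
            ⟨by omega, by omega⟩ ⟨by omega, by omega⟩ ⟨by omega, by omega⟩ (by simpa using hp)
            (by simpa using hq.le) (by simpa using hr)
          simpa using this
        · refine LoopCost.large_small (hN.congr fun j h1 h2 => ?_) hpq hk hp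
          rw [Function.update_of_ne (by omega), Function.update_of_ne (by omega),
              Function.update_of_ne (by omega)]
      · obtain ⟨N, s', hr, hN⟩ := ih
          (Function.update (Function.update c k (c e)) e (c k)) l e
          (c k) (c e) (by omega) hke (by omega) (by omega)
          (fun j h1 h2 => by
            rw [Function.update_of_ne (by omega), Function.update_of_ne (by omega)])
        refine ⟨N + 23, s', ?_, ?_⟩
        · have := runs_scan_medium (left := left) (right := right) (p := p) (q := q) (l := l)
            (g := e) (k := k) (ak := c k) (ag := ag) (n := n) (c := c) (N := N) (s' := s')
            ⟨by omega, by omega⟩ ⟨by omega, by omega⟩ (by simpa using hp.le)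
            (by simpa using hq.le) (by simpa using hr)
          simpa using this
        · refine LoopCost.large_medium (hN.congr fun j h1 h2 => ?_) hpq hk hp hq
          rw [Function.update_of_ne (by omega), Function.update_of_ne (by omega)]
    -- A large entry at the right end is skipped, and the scan goes on in the shorter range.
    · obtain ⟨N, s', hr, hN⟩ := ihe (ag := ag) (by omega) (fun j h1 h2 => hc j h1 (by omega))
        (fun c' l' e' ak ag h1 h2 h3 h4 => ih c' l' e' ak ag h1 h2 h3 (by omega))
      refine ⟨N + 10, s', ?_, ?_⟩
      · have := runs_scan_large (left := left) (right := right) (p := p) (q := q) (l := l)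
            (g := e) (k := k) (ak := c k) (ag := ag) (n := n) (c := c) (N := N) (s' := s')
            (by omega) ⟨by omega, by omega⟩ (by simpa using hq) hr
        simpa using this
      · exact hN.scan_large hpq hq

/-- The main loop terminates without error. -/
theorem exists_runs_loop {left right p q : ℤ} {n : ℕ} (hpq : p ≤ q) (d : ℕ) :
    ∀ {c : ℕ → ℤ} {l k e : ℕ} {ak ag : ℤ}, e - k = d → l ≤ k → k ≤ e → e ≤ n →
      (∀ j, k ≤ j → j < e → c j ≠ p ∧ c j ≠ q) →
      ∃ N s', Runs partitionCode
        ⟨6, [], frame left right p q l ((e : ℤ) - 1) k ak ag, n, c⟩ N s' ∧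
        LoopCost c p q k e N := by
  -- Strong induction, since one iteration may shorten the range by many entries from the right.
  induction d using Nat.strong_induction_on with
  | _ d ih =>
    intro c l k e ak ag hd hl hke hen hc
    rcases hke.eq_or_lt with rfl | hke
    · exact ⟨5, _, runs_loop_exit (by omega), loopCost_empty⟩
    obtain ⟨hp, hq⟩ := hc k le_rfl hke
    rcases lt_or_gt_of_ne hp with hp | hp
    · obtain ⟨N, s', hr, hN⟩ := ih (e - (k + 1)) (by omega)
        (c := Function.update (Function.update c k (c l)) l (c k)) (l := l + 1) (k := k + 1)
        (e := e) (ak := c k) (ag := ag) rfl (by omega) (by omega) hen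
        (fun j h1 h2 => by
          rw [Function.update_of_ne (by omega), Function.update_of_ne (by omega)]
          exact hc j (by omega) h2)
      refine ⟨N + 24, s', ?_, LoopCost.small (hN.congr fun j h1 h2 => ?_) hpq hp⟩
      · exact runs_loop_small (by omega) ⟨by omega, by omega⟩ ⟨by omega, by omega⟩
          (by simpa using hp) (by simpa using hr)
      · rw [Function.update_of_ne (by omega), Function.update_of_ne (by omega)]
    rcases lt_or_gt_of_ne hq with hq | hq
    · obtain ⟨N, s', hr, hN⟩ := ih (e - (k + 1)) (by omega) (c := c) (l := l) (k := k + 1)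
        (e := e) (ak := c k) (ag := ag) rfl (by omega) (by omega) hen
        (fun j h1 h2 => hc j (by omega) h2)
      refine ⟨N + 15, s', ?_, hN.medium hp hq⟩
      exact runs_loop_medium (by omega) ⟨by omega, by omega⟩
          (by simpa using hp.le) (by simpa using hq) (by simpa using hr)
    · obtain ⟨N, s', hr, hN⟩ := exists_runs_scan (left := left) (right := right) (ag := ag)
        hpq hl hke hen hc hq fun c' l' e' ak ag h1 h2 h3 h4 h5 =>
          ih (e' - (k + 1)) (by omega) rfl h1 h2 h3 fun j h6 h7 => by
            rw [h5 j h6 h7]; exact hc j (by omega) (by omega)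
      refine ⟨N + 13, s', ?_, hN⟩
      exact runs_loop_large (by omega) ⟨by omega, by omega⟩
          (by simpa using hp.le) (by simpa using hq.le) (by simpa using hr)

/-- The cost of the loop in terms of the class sizes and of the composition of the initial part
of the range whose length is the number of small and medium entries. -/
theorem LoopCost.abs_sub_le {c : ℕ → ℤ} {p q : ℤ} {k e N d : ℕ} (h : LoopCost c p q k e N)
    (hpq : p ≤ q) (hke : k ≤ e) (hc : ∀ j, k ≤ j → j < e → c j ≠ p ∧ c j ≠ q)
    (hd : d = countIn c (Set.Iio p) k e + countIn c (Set.Ioo p q) k e) :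
    |(N : ℤ) - (10 * (e - k : ℕ) + 13 * countIn c (Set.Iio p) k e + 5 * countIn c (Set.Ioo p q) k e
      + 11 * countIn c (Set.Ioi q) k (k + d) + countIn c (Set.Iio p) k (k + d))| ≤ 100 := by
  obtain ⟨x, δ, ε, h1, h2, h3, h4, h5, h6⟩ := h
  have hke' := countIn_classes hpq hke hc
  have hkx := countIn_classes hpq h1 fun j h7 h8 => hc j h7 (by omega)
  have hxe := countIn_classes hpq h2 fun j h7 h8 => hc j (by omega) h8
  have hs := countIn_add (c := c) (S := Set.Iio p) h1 h2
  have hm := countIn_add (c := c) (S := Set.Ioo p q) h1 h2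
  have hL := countIn_add (c := c) (S := Set.Ioi q) h1 h2
  -- By balance, the large entries before `x` are as many as the small and medium ones after it,
  -- plus δ; so `[k, x)` has length d + δ.
  have hx : x = k + d + δ := by omega
  have h7 := countIn_add (c := c) (S := Set.Iio p) (a := k) (b := k + d) (d := x) (by omega)
    (by omega)
  have h8 := countIn_add (c := c) (S := Set.Ioi q) (a := k) (b := k + d) (d := x) (by omega)
    (by omega)
  have h9 := countIn_le (c := c) (S := Set.Iio p) (a := k + d) (b := x)
  have h10 := countIn_le (c := c) (S := Set.Ioi q) (a := k + d) (b := x)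
  -- Counts up to `x` and up to `k + d` differ by at most δ ≤ 1. The rest is the exchange of 11
  -- units per swap; all error terms together stay well below 100.
  rw [abs_le]
  constructor <;> omega

/-! ### Invariant laws and draws from an urn -/

section PMF

theorem pmf_map_apply_of_injective {α β : Type*} (p : PMF α) {f : α → β}
    (hf : Function.Injective f) (a : α) : p.map f (f a) = p a := by
  classical
  rw [PMF.map_apply, tsum_eq_single a]
  · simp
  · intro b hb
    rw [if_neg fun h => hb (hf h).symm]

theorem uniformOfFintype_map_equiv {α : Type*} [Fintype α] [Nonempty α] (e : α ≃ α) :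
    (PMF.uniformOfFintype α).map e = PMF.uniformOfFintype α := by
  ext a
  obtain ⟨b, rfl⟩ := e.surjective a
  rw [pmf_map_apply_of_injective _ e.injective]
  simp

theorem pmf_eq_uniformOfFinset {α : Type*} (p : PMF α) (s : Finset α) (hs : s.Nonempty)
    (h0 : ∀ a ∉ s, p a = 0) (h : ∀ a ∈ s, ∀ b ∈ s, p a = p b) :
    p = PMF.uniformOfFinset s hs := by
  ext a
  by_cases ha : a ∈ s
  · rw [PMF.uniformOfFinset_apply_of_mem hs ha]
    apply ENNReal.eq_inv_of_mul_eq_one_left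
    have := p.tsum_coe
    rw [tsum_eq_sum (s := s) fun b hb => h0 b hb, Finset.sum_congr rfl fun b hb => h b hb a ha,
      Finset.sum_const, nsmul_eq_mul] at this
    rw [mul_comm, this]
  · rw [PMF.uniformOfFinset_apply_of_notMem hs ha, h0 a ha]

/-- A law that is invariant under the maps `act g` may be averaged over a random `g`. -/
theorem pmf_map_eq_of_invariant {α β γ : Type*} (p : PMF α) (r : PMF γ) (act : γ → α → α)
    (hact : ∀ g, p.map (act g) = p) (f : α → β) (v : PMF β)
    (hv : ∀ a ∈ p.support, r.map (fun g => f (act g a)) = v) : p.map f = v := by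
  calc p.map f = r.bind fun g => p.map fun a => f (act g a) := by
        rw [show (fun g => p.map fun a => f (act g a)) = fun _ => p.map f from ?_, PMF.bind_const]
        funext g
        conv_rhs => rw [← hact g, PMF.map_comp]
        rfl
    _ = p.bind fun a => r.map fun g => f (act g a) := by
        simp only [PMF.map, Function.comp_def]
        exact PMF.bind_comm _ _ _
    _ = p.bind fun _ => v := by
        -- The hypothesis `hv` is available only on the support of `p`, so the two laws are compared
        -- term by term.
        ext b
        rw [PMF.bind_apply, PMF.bind_apply]
        refine tsum_congr fun a => ?_
        by_cases ha : p a = 0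
        · simp [ha]
        · rw [hv a ((PMF.mem_support_iff _ _).2 ha)]
    _ = v := PMF.bind_const _ _

end PMF

/-- Two colourings with the same class sizes differ by a permutation. -/
theorem exists_perm_comp_eq {α β : Type*} [Fintype α] (c c' : α → β)
    (h : ∀ b, Nat.card {x // c x = b} = Nat.card {x // c' x = b}) :
    ∃ e : Equiv.Perm α, ∀ x, c' (e x) = c x := by
  let f : ∀ b, {x // c x = b} ≃ {x // c' x = b} := fun b =>
    (Finite.equivFin _).trans ((finCongr (h b)).trans (Finite.equivFin _).symm)
  refine ⟨(Equiv.sigmaFiberEquiv c).symm.trans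
    ((Equiv.sigmaCongrRight f).trans (Equiv.sigmaFiberEquiv c')), fun x => ?_⟩
  exact (f (c x) ⟨x, rfl⟩).2

theorem exists_perm_map_eq {m : ℕ} {s s' : Finset (Fin m)} (h : s.card = s'.card) :
    ∃ e : Equiv.Perm (Fin m), s.map e.toEmbedding = s' := by
  obtain ⟨e, he⟩ := exists_perm_comp_eq (fun x => decide (x ∈ s)) (fun x => decide (x ∈ s'))
    (by
      rintro (_ | _)
      · simp only [decide_eq_false_iff_not, Nat.card_eq_fintype_card, Fintype.card_subtype_compl,
          Fintype.card_coe, h]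
      · simp only [decide_eq_true_eq, Nat.card_eq_fintype_card, Fintype.card_coe, h])
  refine ⟨e, Finset.eq_of_subset_of_card_le (fun y hy => ?_) (by rw [Finset.card_map, h])⟩
  obtain ⟨x, hx, rfl⟩ := Finset.mem_map.1 hy
  have := he x
  simpa [hx] using this

/-- A random draw is the image of a fixed set under a random permutation. -/
theorem map_perm_eq_draw {m : ℕ} (D : Finset (Fin m)) :
    (PMF.uniformOfFintype (Equiv.Perm (Fin m))).map (fun π => D.map π.toEmbedding) =
      draw D.card m := by
  have hD : min D.card m = D.card := min_eq_left (by simpa using Finset.card_le_univ D)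
  refine pmf_eq_uniformOfFinset _ _ _ (fun s hs => ?_) fun s hs s' hs' => ?_
  · rw [hD, Finset.mem_powersetCard_univ] at hs
    by_contra h
    obtain ⟨π, -, rfl⟩ := (PMF.mem_support_map_iff _ _ _).1 ((PMF.mem_support_iff _ _).2 h)
    exact hs (Finset.card_map _)
  · rw [Finset.mem_powersetCard_univ] at hs hs'
    obtain ⟨e, rfl⟩ := exists_perm_map_eq (hs.trans hs'.symm)
    -- Left multiplication by `e` preserves the uniform law and carries the outcome `s` to its
    -- image, so all sets of this size are equally likely.
    conv_rhs => rw [← uniformOfFintype_map_equiv (Equiv.mulLeft e), PMF.map_comp]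
    rw [← pmf_map_apply_of_injective _ (f := fun s : Finset (Fin m) => s.map e.toEmbedding)
      (Finset.map_injective _), PMF.map_comp]
    congr 2
    funext π
    simp only [Function.comp_apply, Finset.map_map]
    rfl

/-- The factor `e` makes room for renaming positions as balls of the matching colour. -/
theorem map_perm_comp_eq_draw {m : ℕ} (D : Finset (Fin m)) (e : Equiv.Perm (Fin m)) :
    (PMF.uniformOfFintype (Equiv.Perm (Fin m))).map (fun π => D.map (e * π).toEmbedding) =
      draw D.card m := by
  rw [← map_perm_eq_draw]
  conv_rhs => rw [← uniformOfFintype_map_equiv (Equiv.mulLeft e), PMF.map_comp]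
  rfl

theorem card_filter_val_lt {m d : ℕ} (hd : d ≤ m) :
    (Finset.univ.filter fun x : Fin m => (x : ℕ) < d).card = d := by
  rw [Fin.card_filter_val_lt, min_eq_right hd]

theorem card_filter_le_val_add {m d : ℕ} (hd : d ≤ m) :
    (Finset.univ.filter fun x : Fin m => m ≤ (x : ℕ) + d).card = d := by
  refine (Finset.card_bij' (fun x _ => x.rev) (fun x _ => x.rev) ?_ ?_ ?_ ?_).trans
    (card_filter_val_lt hd) <;> simp [Fin.val_rev] <;> omega

/-- Symmetry of the hypergeometric distribution in draws and coloured balls. -/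
theorem draw_map_last_eq_hypergeometric {m d b : ℕ} (hd : d ≤ m) (hb : b ≤ m) :
    (draw d m).map (fun s => (s.filter fun x : Fin m => m ≤ (x : ℕ) + b).card) =
      hypergeometric b d m := by
  unfold hypergeometric
  -- With D the first `d` and B the last `b` balls, |πD ∩ B| = |D ∩ π⁻¹B|, and π⁻¹ is as uniform as
  -- π.
  conv_lhs => rw [← card_filter_val_lt hd]
  conv_rhs => rw [← card_filter_le_val_add hb]
  rw [← map_perm_eq_draw, ← map_perm_eq_draw]
  conv_rhs => rw [← uniformOfFintype_map_equiv (Equiv.inv _), PMF.map_comp]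
  rw [PMF.map_comp, PMF.map_comp]
  congr 1
  funext π
  simp only [Function.comp_apply]
  refine Finset.card_bij' (fun x _ => π⁻¹ x) (fun x _ => π x) ?_ ?_ ?_ ?_ <;> simp
  · intro x hx hx'
    exact ⟨by rwa [show Equiv.symm π⁻¹ (Equiv.symm π x) = x from π.apply_symm_apply x], hx⟩
  · exact fun x hx hx' => ⟨hx', hx⟩

/-! ### Sample, ordinary elements and the cost on a given array -/

variable (t₁ t₂ t₃ : ℕ) {n : ℕ}

/-- The `x`-th ordinary position. -/
def ordinaryEmbedding (n : ℕ) : Fin (n - sampleSize t₁ t₂ t₃) ↪ Fin n where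
  toFun x := ⟨t₁ + t₂ + 1 + x, by have := x.2; unfold sampleSize at this; omega⟩
  inj' x y h := by
    have := congrArg Fin.val h
    exact Fin.ext (by simpa using this)

variable {t₁ t₂ t₃}

@[simp]
theorem val_ordinaryEmbedding (x : Fin (n - sampleSize t₁ t₂ t₃)) :
    (ordinaryEmbedding t₁ t₂ t₃ n x : ℕ) = t₁ + t₂ + 1 + x := rfl

theorem ordinaryPositions_eq_map :
    ordinaryPositions t₁ t₂ t₃ n = Finset.univ.map (ordinaryEmbedding t₁ t₂ t₃ n) := by
  ext j
  simp only [ordinaryPositions, samplePositions, Finset.mem_compl, Finset.mem_filter,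
    Finset.mem_univ, true_and, Finset.mem_map]
  constructor
  · intro h
    have := j.2
    exact ⟨⟨j - (t₁ + t₂ + 1), by unfold sampleSize; omega⟩, Fin.ext (by simp; omega)⟩
  · rintro ⟨x, rfl⟩
    have := x.2
    unfold sampleSize at this
    simp only [val_ordinaryEmbedding]
    omega

theorem ordinaryEmbedding_notMem_samplePositions (x : Fin (n - sampleSize t₁ t₂ t₃)) :
    ordinaryEmbedding t₁ t₂ t₃ n x ∉ samplePositions t₁ t₂ t₃ n := by
  rw [← Finset.mem_compl, ← ordinaryPositions, ordinaryPositions_eq_map]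
  exact Finset.mem_map_of_mem _ (Finset.mem_univ _)

theorem card_samplePositions (h : sampleSize t₁ t₂ t₃ ≤ n) :
    (samplePositions t₁ t₂ t₃ n).card = sampleSize t₁ t₂ t₃ := by
  have h1 := Finset.card_compl (samplePositions t₁ t₂ t₃ n)
  have h2 : (samplePositions t₁ t₂ t₃ n).card ≤ Fintype.card (Fin n) := Finset.card_le_univ _
  rw [← ordinaryPositions, ordinaryPositions_eq_map, Finset.card_map] at h1
  simp only [Finset.card_univ, Fintype.card_fin] at h1 h2
  omega

theorem length_sortedSample (h : sampleSize t₁ t₂ t₃ ≤ n) (a : Fin n → ℤ) :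
    (sortedSample t₁ t₂ t₃ a).length = sampleSize t₁ t₂ t₃ := by
  rw [sortedSample, Multiset.length_sort, Multiset.card_map]
  exact card_samplePositions h

theorem sortedSample_getD_ne {a : Fin n → ℤ} (ha : Function.Injective a) {i : ℕ}
    (hi : i < (sortedSample t₁ t₂ t₃ a).length) (x : Fin (n - sampleSize t₁ t₂ t₃)) :
    a (ordinaryEmbedding t₁ t₂ t₃ n x) ≠ (sortedSample t₁ t₂ t₃ a).getD i 0 := by
  -- The index is in range, so the default value 0 of `getD` plays no role and the entry really
  -- comes from the sample.
  rw [List.getD_eq_getElem _ _ hi]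
  intro h
  have hmem := List.getElem_mem hi
  rw [← h, sortedSample, Multiset.mem_sort, Multiset.mem_map] at hmem
  obtain ⟨j, hj, hja⟩ := hmem
  rw [ha hja] at hj
  exact ordinaryEmbedding_notMem_samplePositions x hj

theorem ne_pivotP (h : sampleSize t₁ t₂ t₃ ≤ n) {a : Fin n → ℤ} (ha : Function.Injective a)
    (x : Fin (n - sampleSize t₁ t₂ t₃)) :
    a (ordinaryEmbedding t₁ t₂ t₃ n x) ≠ pivotP t₁ t₂ t₃ a :=
  sortedSample_getD_ne ha (by rw [length_sortedSample h, sampleSize]; omega) x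

theorem ne_pivotQ (h : sampleSize t₁ t₂ t₃ ≤ n) {a : Fin n → ℤ} (ha : Function.Injective a)
    (x : Fin (n - sampleSize t₁ t₂ t₃)) :
    a (ordinaryEmbedding t₁ t₂ t₃ n x) ≠ pivotQ t₁ t₂ t₃ a :=
  sortedSample_getD_ne ha (by rw [length_sortedSample h, sampleSize]; omega) x

theorem pivotP_le_pivotQ (h : sampleSize t₁ t₂ t₃ ≤ n) (a : Fin n → ℤ) :
    pivotP t₁ t₂ t₃ a ≤ pivotQ t₁ t₂ t₃ a := by
  have hl := length_sortedSample h a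
  rw [sampleSize] at hl
  have h1 : t₁ < (sortedSample t₁ t₂ t₃ a).length := by omega
  have h2 : t₁ + t₂ + 1 < (sortedSample t₁ t₂ t₃ a).length := by omega
  rw [pivotP, pivotQ, List.getD_eq_getElem _ _ h1, List.getD_eq_getElem _ _ h2]
  exact List.pairwise_iff_getElem.1 (Multiset.pairwise_sort _ _) _ _ h1 h2 (by omega)

theorem sampleSortedArray_ordinary (a : Fin n → ℤ) (x : Fin (n - sampleSize t₁ t₂ t₃)) :
    sampleSortedArray t₁ t₂ t₃ a (t₁ + t₂ + 1 + x) = a (ordinaryEmbedding t₁ t₂ t₃ n x) := by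
  have := x.2
  unfold sampleSize at this
  rw [sampleSortedArray, if_neg (by omega), if_neg (by omega), dif_pos (by omega)]
  rfl

theorem countIn_sampleSortedArray (a : Fin n → ℤ) (S : Set ℤ) [DecidablePred (· ∈ S)] {d : ℕ}
    (hd : d ≤ n - sampleSize t₁ t₂ t₃) :
    countIn (sampleSortedArray t₁ t₂ t₃ a) S (t₁ + t₂ + 1) (t₁ + t₂ + 1 + d) =
      (Finset.univ.filter fun x : Fin (n - sampleSize t₁ t₂ t₃) =>
        (x : ℕ) < d ∧ a (ordinaryEmbedding t₁ t₂ t₃ n x) ∈ S).card := by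
  rw [countIn, ← Set.ncard_coe_finset, ← Set.ncard_image_of_injective
    (f := fun x : Fin (n - sampleSize t₁ t₂ t₃) => t₁ + t₂ + 1 + (x : ℕ)) _
    (fun x y h => Fin.ext (by simpa using h))]
  congr 1
  ext j
  simp only [Set.mem_ofPred_eq, Finset.coe_filter, Finset.mem_univ, true_and, Set.mem_image]
  constructor
  · rintro ⟨h1, h2, h3⟩
    obtain ⟨x, rfl⟩ := Nat.exists_eq_add_of_le h1
    have h4 := sampleSortedArray_ordinary a ⟨x, show x < n - sampleSize t₁ t₂ t₃ by omega⟩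
    simp only at h4
    rw [h4] at h3
    exact ⟨⟨x, by omega⟩, ⟨by simp; omega, h3⟩, rfl⟩
  · rintro ⟨x, ⟨h1, h2⟩, rfl⟩
    rw [sampleSortedArray_ordinary]
    exact ⟨by omega, by omega, h2⟩

theorem partitionSizes_eq_countIn (a : Fin n → ℤ) :
    partitionSizes t₁ t₂ t₃ a =
      (countIn (sampleSortedArray t₁ t₂ t₃ a) (Set.Iio (pivotP t₁ t₂ t₃ a)) (t₁ + t₂ + 1)
        (t₁ + t₂ + 1 + (n - sampleSize t₁ t₂ t₃)),
      countIn (sampleSortedArray t₁ t₂ t₃ a) (Set.Ioo (pivotP t₁ t₂ t₃ a) (pivotQ t₁ t₂ t₃ a))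
        (t₁ + t₂ + 1) (t₁ + t₂ + 1 + (n - sampleSize t₁ t₂ t₃)),
      countIn (sampleSortedArray t₁ t₂ t₃ a) (Set.Ioi (pivotQ t₁ t₂ t₃ a)) (t₁ + t₂ + 1)
        (t₁ + t₂ + 1 + (n - sampleSize t₁ t₂ t₃))) := by
  simp only [countIn_sampleSortedArray _ _ le_rfl, partitionSizes, ordinaryPositions_eq_map,
    Finset.filter_map, Finset.card_map, Function.comp_def, Fin.is_lt, true_and, Set.mem_Iio,
    Set.mem_Ioo, Set.mem_Ioi]

theorem sampleSortedArray_ne_pivots (h : sampleSize t₁ t₂ t₃ ≤ n) {a : Fin n → ℤ}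
    (ha : Function.Injective a) (j : ℕ) (h1 : t₁ + t₂ + 1 ≤ j)
    (h2 : j < t₁ + t₂ + 1 + (n - sampleSize t₁ t₂ t₃)) :
    sampleSortedArray t₁ t₂ t₃ a j ≠ pivotP t₁ t₂ t₃ a ∧
      sampleSortedArray t₁ t₂ t₃ a j ≠ pivotQ t₁ t₂ t₃ a := by
  obtain ⟨x, rfl⟩ := Nat.exists_eq_add_of_le h1
  have h3 := sampleSortedArray_ordinary a ⟨x, show x < n - sampleSize t₁ t₂ t₃ by omega⟩
  simp only at h3
  rw [h3]
  exact ⟨ne_pivotP h ha _, ne_pivotQ h ha _⟩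

theorem partitionSizes_add (h : sampleSize t₁ t₂ t₃ ≤ n) {a : Fin n → ℤ}
    (ha : Function.Injective a) {i₁ i₂ i₃ : ℕ} (hi : partitionSizes t₁ t₂ t₃ a = (i₁, i₂, i₃)) :
    i₁ + i₂ + i₃ = n - sampleSize t₁ t₂ t₃ := by
  have := countIn_classes (pivotP_le_pivotQ h a) (Nat.le_add_right _ _)
    (sampleSortedArray_ne_pivots h ha)
  rw [partitionSizes_eq_countIn, Prod.mk.injEq, Prod.mk.injEq] at hi
  omega

theorem partitionStart_eq (a : Fin n → ℤ) :
    partitionStart t₁ t₂ t₃ a = ⟨0, [], frame (t₁ + t₂ + 1) (n - t₃ - 2) (pivotP t₁ t₂ t₃ a)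
      (pivotQ t₁ t₂ t₃ a) 0 0 0 0 0, n, sampleSortedArray t₁ t₂ t₃ a⟩ := by
  rw [partitionStart, State.mk.injEq]
  refine ⟨rfl, rfl, ?_, rfl, rfl⟩
  funext v
  rcases v with _ | _ | _ | _ | _ | _ | _ | _ | _ | _ | v <;> rfl

variable (t₁ t₂ t₃)

/-- The number of large elements among the first `I₁ + I₂` ordinary elements. -/
noncomputable def largeInHead (a : Fin n → ℤ) : ℕ :=
  (Finset.univ.filter fun x : Fin (n - sampleSize t₁ t₂ t₃) =>
    (x : ℕ) < (partitionSizes t₁ t₂ t₃ a).1 + (partitionSizes t₁ t₂ t₃ a).2.1 ∧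
      a (ordinaryEmbedding t₁ t₂ t₃ n x) ∈ Set.Ioi (pivotQ t₁ t₂ t₃ a)).card

/-- The number of small elements among the first `I₁ + I₂` ordinary elements. -/
noncomputable def smallInHead (a : Fin n → ℤ) : ℕ :=
  (Finset.univ.filter fun x : Fin (n - sampleSize t₁ t₂ t₃) =>
    (x : ℕ) < (partitionSizes t₁ t₂ t₃ a).1 + (partitionSizes t₁ t₂ t₃ a).2.1 ∧
      a (ordinaryEmbedding t₁ t₂ t₃ n x) ∈ Set.Iio (pivotP t₁ t₂ t₃ a)).card

variable {t₁ t₂ t₃}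

theorem exists_partitionBytecodes (h : sampleSize t₁ t₂ t₃ ≤ n) {a : Fin n → ℤ}
    (ha : Function.Injective a) :
    ∃ N, PartitionBytecodes t₁ t₂ t₃ a N ∧ ∀ i₁ i₂ i₃ : ℕ,
      partitionSizes t₁ t₂ t₃ a = (i₁, i₂, i₃) →
      |(N : ℤ) - (10 * (n - sampleSize t₁ t₂ t₃ : ℕ) + 13 * i₁ + 5 * i₂ +
        11 * largeInHead t₁ t₂ t₃ a + smallInHead t₁ t₂ t₃ a)| ≤ 106 := by
  have hpq := pivotP_le_pivotQ h a
  have hne := sampleSortedArray_ne_pivots h ha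
  -- The exclusive end `e` of the range is one more than `right`.
  have hm : t₁ + t₂ + 1 + (n - sampleSize t₁ t₂ t₃) = n - t₃ - 1 := by
    unfold sampleSize at *; omega
  obtain ⟨N, s', hr, hN⟩ := exists_runs_loop (left := (t₁ : ℤ) + t₂ + 1) (right := (n : ℤ) - t₃ - 2)
    hpq (n - sampleSize t₁ t₂ t₃) (n := n) (c := sampleSortedArray t₁ t₂ t₃ a)
    (l := t₁ + t₂ + 1) (k := t₁ + t₂ + 1) (e := t₁ + t₂ + 1 + (n - sampleSize t₁ t₂ t₃))
    (ak := 0) (ag := 0) (by omega) le_rfl (by omega) (by omega) hne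
  -- The 6 initial instructions turn the loop's error bound 100 into 106.
  refine ⟨N + 6, ⟨s', ?_⟩, fun i₁ i₂ i₃ hi => ?_⟩
  · rw [partitionStart_eq]
    refine runs_partitionStart ?_
    rw [hm, Nat.cast_sub (by unfold sampleSize at h; omega),
      Nat.cast_sub (by unfold sampleSize at h; omega)] at hr
    convert hr using 3 <;> push_cast <;> ring
  · have hadd := partitionSizes_add h ha hi
    have hi' := hi
    rw [partitionSizes_eq_countIn, Prod.mk.injEq, Prod.mk.injEq] at hi'
    have := hN.abs_sub_le (d := i₁ + i₂) hpq (by omega) hne (by omega)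
    rw [countIn_sampleSortedArray (d := i₁ + i₂) _ _ (by omega),
      countIn_sampleSortedArray (d := i₁ + i₂) _ _ (by omega), hi'.1, hi'.2.1] at this
    rw [largeInHead, smallInHead, hi]
    rw [abs_le] at *
    push_cast at *
    rw [Nat.add_sub_cancel_left] at this
    omega

/-! ### Rearranging the ordinary elements -/

section invariance
variable {a : Fin n → ℤ} (π : Equiv.Perm (Fin (n - sampleSize t₁ t₂ t₃)))

/-- The extended permutation fixes every sample position. -/
theorem sortedSample_comp_viaEmbedding :
    sortedSample t₁ t₂ t₃ (a ∘ π.viaEmbedding (ordinaryEmbedding t₁ t₂ t₃ n)) =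
      sortedSample t₁ t₂ t₃ a := by
  unfold sortedSample
  congr 1
  refine Multiset.map_congr rfl fun j hj => ?_
  rw [Function.comp_apply, Equiv.Perm.viaEmbedding_apply_of_notMem]
  rintro ⟨x, rfl⟩
  exact ordinaryEmbedding_notMem_samplePositions x hj

theorem pivotP_comp_viaEmbedding :
    pivotP t₁ t₂ t₃ (a ∘ π.viaEmbedding (ordinaryEmbedding t₁ t₂ t₃ n)) = pivotP t₁ t₂ t₃ a := by
  rw [pivotP, sortedSample_comp_viaEmbedding, pivotP]

theorem pivotQ_comp_viaEmbedding :
    pivotQ t₁ t₂ t₃ (a ∘ π.viaEmbedding (ordinaryEmbedding t₁ t₂ t₃ n)) = pivotQ t₁ t₂ t₃ a := by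
  rw [pivotQ, sortedSample_comp_viaEmbedding, pivotQ]

theorem card_filter_perm {α : Type*} [Fintype α] (e : Equiv.Perm α) (S : α → Prop)
    [DecidablePred S] :
    (Finset.univ.filter fun x => S (e x)).card = (Finset.univ.filter S).card :=
  Finset.card_equiv e (by simp)

theorem partitionSizes_comp_viaEmbedding :
    partitionSizes t₁ t₂ t₃ (a ∘ π.viaEmbedding (ordinaryEmbedding t₁ t₂ t₃ n)) =
      partitionSizes t₁ t₂ t₃ a := by
  rw [partitionSizes, pivotP_comp_viaEmbedding, pivotQ_comp_viaEmbedding, partitionSizes]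
  simp only [ordinaryPositions_eq_map, Finset.filter_map, Finset.card_map, Function.comp_def,
    Equiv.Perm.viaEmbedding_apply, Prod.mk.injEq]
  exact ⟨card_filter_perm π fun x => a (ordinaryEmbedding t₁ t₂ t₃ n x) < pivotP t₁ t₂ t₃ a,
    card_filter_perm π fun x => pivotP t₁ t₂ t₃ a < a (ordinaryEmbedding t₁ t₂ t₃ n x) ∧
      a (ordinaryEmbedding t₁ t₂ t₃ n x) < pivotQ t₁ t₂ t₃ a,
    card_filter_perm π fun x => pivotQ t₁ t₂ t₃ a < a (ordinaryEmbedding t₁ t₂ t₃ n x)⟩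

end invariance

theorem permArray_mul (σ τ : Equiv.Perm (Fin n)) : permArray (σ * τ) = permArray σ ∘ τ := rfl

theorem permArray_injective (σ : Equiv.Perm (Fin n)) : Function.Injective (permArray σ) := by
  intro i j h
  simpa [permArray, Fin.val_inj] using h

/-- Right multiplication by `τ` is a bijection that preserves the conditioning event, on which the
law is uniform. -/
theorem permGivenSizes_map_mul_right {i : ℕ × ℕ × ℕ}
    (hi : ∃ σ : Equiv.Perm (Fin n), partitionSizes t₁ t₂ t₃ (permArray σ) = i)
    (τ : Equiv.Perm (Fin n)) (hτ : ∀ σ : Equiv.Perm (Fin n),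
      partitionSizes t₁ t₂ t₃ (permArray (σ * τ)) = partitionSizes t₁ t₂ t₃ (permArray σ)) :
    (permGivenSizes t₁ t₂ t₃ n i hi).map (· * τ) = permGivenSizes t₁ t₂ t₃ n i hi := by
  ext σ
  obtain ⟨σ, rfl⟩ : ∃ σ', σ' * τ = σ := ⟨σ * τ⁻¹, by simp⟩
  rw [pmf_map_apply_of_injective _ (f := (· * τ)) (mul_left_injective τ)]
  simp only [permGivenSizes, PMF.filter_apply, Set.indicator, Set.mem_ofPred_eq, hτ,
    PMF.uniformOfFintype_apply]

/-! ### Elements as coloured balls, and the joint law -/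

/-- The class of an element: small, medium or large. -/
def pivotClass (p q z : ℤ) : Ordering := if z < p then .lt else if q < z then .gt else .eq

/-- The colour of a ball: blue, other, or red. -/
def ballClass (r b m : ℕ) (x : Fin m) : Ordering :=
  if (x : ℕ) < r then .gt else if m ≤ (x : ℕ) + b then .lt else .eq

/-- Small, medium and large elements are as numerous as blue, uncoloured and red balls, so some
bijection matches the colours. -/
theorem exists_perm_ballClass_eq (h : sampleSize t₁ t₂ t₃ ≤ n) {a : Fin n → ℤ}
    (ha : Function.Injective a) {i₁ i₂ i₃ : ℕ} (hi : partitionSizes t₁ t₂ t₃ a = (i₁, i₂, i₃)) :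
    ∃ e : Equiv.Perm (Fin (n - sampleSize t₁ t₂ t₃)), ∀ x,
      ballClass i₃ i₁ (n - sampleSize t₁ t₂ t₃) (e x) =
        pivotClass (pivotP t₁ t₂ t₃ a) (pivotQ t₁ t₂ t₃ a)
          (a (ordinaryEmbedding t₁ t₂ t₃ n x)) := by
  have hadd := partitionSizes_add h ha hi
  have hpq := pivotP_le_pivotQ h a
  refine exists_perm_comp_eq _ _ fun o => ?_
  simp only [partitionSizes, ordinaryPositions_eq_map, Finset.filter_map, Finset.card_map,
    Function.comp_def, Prod.mk.injEq] at hi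
  simp only [Nat.card_eq_fintype_card, Fintype.card_subtype]
  rcases o with _ | _ | _
  · trans i₁
    · refine Eq.trans ?_ hi.1
      congr 1
      ext x
      simp only [Finset.mem_filter, Finset.mem_univ, true_and]
      unfold pivotClass
      split_ifs <;> simp <;> omega
    · refine Eq.trans (card_filter_le_val_add (m := n - sampleSize t₁ t₂ t₃) (d := i₁) (by omega)).symm ?_
      congr 1
      ext x
      simp only [Finset.mem_filter, Finset.mem_univ, true_and]
      unfold ballClass
      split_ifs <;> simp <;> omega
  · trans i₂
    · refine Eq.trans ?_ hi.2.1
      congr 1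
      ext x
      -- `pivotClass` would also count elements equal to a pivot as medium; there are none among the
      -- ordinary ones.
      have h1 := ne_pivotP h ha x
      have h2 := ne_pivotQ h ha x
      simp only [Finset.mem_filter, Finset.mem_univ, true_and]
      unfold pivotClass
      split_ifs <;> simp <;> omega
    -- As i₁ + i₂ + i₃ is the size of the urn, the uncoloured balls are those from i₃ to i₃ + i₂ -
    -- 1.
    · have h1 := card_filter_val_lt (m := n - sampleSize t₁ t₂ t₃) (d := i₃ + i₂) (by omega)
      have h2 := card_filter_val_lt (m := n - sampleSize t₁ t₂ t₃) (d := i₃) (by omega)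
      have h3 := Finset.card_sdiff_add_card_eq_card (s := Finset.univ.filter
        fun x : Fin (n - sampleSize t₁ t₂ t₃) => (x : ℕ) < i₃) (t := Finset.univ.filter
        fun x : Fin (n - sampleSize t₁ t₂ t₃) => (x : ℕ) < i₃ + i₂)
        (Finset.monotone_filter_right _ fun x _ hx => by omega)
      rw [h1, h2] at h3
      trans (Finset.univ.filter (fun x : Fin (n - sampleSize t₁ t₂ t₃) => (x : ℕ) < i₃ + i₂) \
        Finset.univ.filter fun x : Fin (n - sampleSize t₁ t₂ t₃) => (x : ℕ) < i₃).card
      · omega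
      congr 1
      ext x
      simp only [Finset.mem_filter, Finset.mem_univ, true_and, Finset.mem_sdiff]
      unfold ballClass
      split_ifs <;> simp <;> omega
  · trans i₃
    · refine Eq.trans ?_ hi.2.2
      congr 1
      ext x
      simp only [Finset.mem_filter, Finset.mem_univ, true_and]
      unfold pivotClass
      split_ifs <;> simp <;> omega
    · refine Eq.trans (card_filter_val_lt (m := n - sampleSize t₁ t₂ t₃) (d := i₃) (by omega)).symm ?_
      congr 1
      ext x
      simp only [Finset.mem_filter, Finset.mem_univ, true_and]
      unfold ballClass
      split_ifs <;> simp <;> omega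

theorem map_head_eq_hypergeometricPair (h : sampleSize t₁ t₂ t₃ ≤ n) {i₁ i₂ i₃ : ℕ}
    (hi : ∃ σ : Equiv.Perm (Fin n), partitionSizes t₁ t₂ t₃ (permArray σ) = (i₁, i₂, i₃)) :
    (permGivenSizes t₁ t₂ t₃ n (i₁, i₂, i₃) hi).map (fun σ =>
        (largeInHead t₁ t₂ t₃ (permArray σ), smallInHead t₁ t₂ t₃ (permArray σ))) =
      hypergeometricPair (i₁ + i₂) i₃ i₁ (n - sampleSize t₁ t₂ t₃) := by
  have hadd : i₁ + i₂ + i₃ = n - sampleSize t₁ t₂ t₃ := by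
    obtain ⟨σ, hσ⟩ := hi
    exact partitionSizes_add h (permArray_injective σ) hσ
  refine pmf_map_eq_of_invariant _
    (PMF.uniformOfFintype (Equiv.Perm (Fin (n - sampleSize t₁ t₂ t₃))))
    (fun π σ => σ * π.viaEmbedding (ordinaryEmbedding t₁ t₂ t₃ n))
    (fun π => permGivenSizes_map_mul_right hi _ fun σ => by
      rw [permArray_mul, partitionSizes_comp_viaEmbedding]) _ _ fun σ hσ => ?_
  have hσ : partitionSizes t₁ t₂ t₃ (permArray σ) = (i₁, i₂, i₃) :=
    ((PMF.mem_support_filter_iff _).1 hσ).1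
  have hpq := pivotP_le_pivotQ h (permArray σ)
  obtain ⟨e, he⟩ := exists_perm_ballClass_eq h (permArray_injective σ) hσ
  rw [hypergeometricPair]
  conv_rhs => rw [← card_filter_val_lt (m := n - sampleSize t₁ t₂ t₃) (d := i₁ + i₂) (by omega)]
  -- The drawn set is the image of the head under `e * π`: `π` picks the element that lands at a
  -- head position, `e` names its ball.
  rw [← map_perm_comp_eq_draw _ e, PMF.map_comp]
  congr 1
  funext π
  simp only [Function.comp_apply, largeInHead, smallInHead, permArray_mul,
    partitionSizes_comp_viaEmbedding, pivotP_comp_viaEmbedding, pivotQ_comp_viaEmbedding,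
    Equiv.Perm.viaEmbedding_apply, hσ, Finset.filter_map, Finset.card_map, Finset.filter_filter,
    Prod.mk.injEq]
  constructor
  · congr 1
    ext x
    have := he (π x)
    simp only [Finset.mem_filter, Finset.mem_univ, true_and, Set.mem_Ioi]
    refine and_congr_right fun _ => ?_
    simp only [Equiv.toEmbedding_apply, Equiv.Perm.mul_apply]
    unfold ballClass pivotClass at this
    split_ifs at this <;> omega
  · congr 1
    ext x
    have := he (π x)
    simp only [Finset.mem_filter, Finset.mem_univ, true_and, Set.mem_Iio]
    refine and_congr_right fun _ => ?_
    simp only [Equiv.toEmbedding_apply, Equiv.Perm.mul_apply]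
    unfold ballClass pivotClass at this
    split_ifs at this <;> omega

end Yaroslavskiy

/-! ### Assembly -/

theorem lemma5p3 (t₁ t₂ t₃ : ℕ) :
    ∃ C : ℝ, ∀ w n : ℕ, Yaroslavskiy.sampleSize t₁ t₂ t₃ - 1 ≤ w → w < n →
      ∃ T X Y : Equiv.Perm (Fin n) → ℕ,
        (∀ σ, Yaroslavskiy.PartitionBytecodes t₁ t₂ t₃ (Yaroslavskiy.permArray σ) (T σ)) ∧
        (∀ σ (i₁ i₂ i₃ : ℕ),
          Yaroslavskiy.partitionSizes t₁ t₂ t₃ (Yaroslavskiy.permArray σ) = (i₁, i₂, i₃) →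
          |(T σ : ℝ) - (10 * n + 13 * i₁ + 5 * i₂ + 11 * X σ + Y σ)| ≤ C) ∧
        ∀ (i₁ i₂ i₃ : ℕ)
          (hi : ∃ σ : Equiv.Perm (Fin n),
            Yaroslavskiy.partitionSizes t₁ t₂ t₃ (Yaroslavskiy.permArray σ) = (i₁, i₂, i₃)),
          (Yaroslavskiy.permGivenSizes t₁ t₂ t₃ n (i₁, i₂, i₃) hi).map X =
            Yaroslavskiy.hypergeometric (i₁ + i₂) i₃ (n - Yaroslavskiy.sampleSize t₁ t₂ t₃) ∧
          (Yaroslavskiy.permGivenSizes t₁ t₂ t₃ n (i₁, i₂, i₃) hi).map Y =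
            Yaroslavskiy.hypergeometric i₁ (i₁ + i₂) (n - Yaroslavskiy.sampleSize t₁ t₂ t₃) ∧
          (Yaroslavskiy.permGivenSizes t₁ t₂ t₃ n (i₁, i₂, i₃) hi).map (fun σ => (X σ, Y σ)) =
            Yaroslavskiy.hypergeometricPair (i₁ + i₂) i₃ i₁
              (n - Yaroslavskiy.sampleSize t₁ t₂ t₃) := by
  open Yaroslavskiy in
  -- The second summand pays for replacing 10(n - k) by 10n.
  refine ⟨106 + 10 * sampleSize t₁ t₂ t₃, fun w n hw hn => ?_⟩
  have h : sampleSize t₁ t₂ t₃ ≤ n := by omega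
  choose T hT hTb using fun σ : Equiv.Perm (Fin n) =>
    exists_partitionBytecodes h (permArray_injective σ)
  refine ⟨T, fun σ => largeInHead t₁ t₂ t₃ (permArray σ),
    fun σ => smallInHead t₁ t₂ t₃ (permArray σ), hT, fun σ i₁ i₂ i₃ hi => ?_,
    fun i₁ i₂ i₃ hi => ?_⟩
  · have hb := hTb σ i₁ i₂ i₃ hi
    have : |(T σ : ℤ) - (10 * n + 13 * i₁ + 5 * i₂ + 11 * largeInHead t₁ t₂ t₃ (permArray σ) +
        smallInHead t₁ t₂ t₃ (permArray σ))| ≤ 106 + 10 * sampleSize t₁ t₂ t₃ := by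
      rw [abs_le] at *
      omega
    exact_mod_cast this
  · have hpair := map_head_eq_hypergeometricPair h hi
    have hadd : i₁ + i₂ + i₃ = n - sampleSize t₁ t₂ t₃ := by
      obtain ⟨σ, hσ⟩ := hi
      exact partitionSizes_add h (permArray_injective σ) hσ
    refine ⟨?_, ?_, hpair⟩
    · have := congrArg (PMF.map Prod.fst) hpair
      rwa [hypergeometricPair, PMF.map_comp, PMF.map_comp] at this
    · have := congrArg (PMF.map Prod.snd) hpair
      rw [hypergeometricPair, PMF.map_comp, PMF.map_comp] at this
      -- The marginal counts i₁ blue balls in i₁ + i₂ draws; the claimed law has these two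
      -- parameters exchanged.
      rw [← draw_map_last_eq_hypergeometric (by omega) (by omega)]
      exact this
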